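/- Let $\|\cdot\|$ denote the spectral norm, let $L>0$, let $n,d\ge 1$ be integers and let $\delta\in(0,1/2]$ be such that $$\max\{3,\lceil Le^2\rceil\}\le \log n+1\le\left(\frac{16n}{\log(d/\delta)+\log(ne)}\right)^{1/3}.$$ Let $(X_k)_{k\in\mathbb Z}$ be independent random real or complex $d\times d$ matrices with common expectation $\mathbb E X_k=X$ and with $\|X_k\|\le L$ almost surely for every $k$, and put $$Z_n=\Big(I+\tfrac1nX_n\Big)\Big(I+\tfrac1nX_{n-1}\Big)\cdots\Big(I+\tfrac1nX_1\Big).$$ Then, with probability exceeding $1-2\delta$, $$\|Z_n-e^X\|\le\frac{2Le^L\log n}{\sqrt n}\left(2\sqrt{\log(2d/\delta)+(\log n)^2}+\frac{\log n}{\sqrt n}\right)+\frac{L^2e^L}{2n}.$$ Consequently, there is a constant $C_L$ depending only on $L$ such that, for all such $n,d,\delta$ and $(X_k)$, with probability exceeding $1-\delta$, $$\|Z_n-e^X\|\le C_L\,\frac{(\log n)^2\log(d/\delta)}{\sqrt n}.$$ -/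

import Mathlib

open scoped Matrix.Norms.L2Operator
open MeasureTheory ProbabilityTheory

/-- The entrywise (product) σ-algebra on `d × d` matrices; it is the Borel σ-algebra. -/
instance matrixMeasurableSpace {𝕜 : Type*} [RCLike 𝕜] {d : ℕ} :
    MeasurableSpace (Matrix (Fin d) (Fin d) 𝕜) :=
  inferInstanceAs (MeasurableSpace (Fin d → Fin d → 𝕜))

/-- `X` is a sequence, indexed by `ℤ`, of independent random `d × d` matrices with common
(entrywise) expectation `M` and with spectral norms bounded by `L` almost surely. -/
structure IsBoundedIndepSeq {𝕜 Ω : Type*} [RCLike 𝕜] [MeasurableSpace Ω] (P : Measure Ω) {d : ℕ}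
    (L : ℝ) (M : Matrix (Fin d) (Fin d) 𝕜) (X : ℤ → Ω → Matrix (Fin d) (Fin d) 𝕜) : Prop where
  measurable : ∀ k, Measurable (X k)
  indep : iIndepFun X P
  mean : ∀ k i j, ∫ ω, X k ω i j ∂P = M i j
  bound : ∀ k, ∀ᵐ ω ∂P, ‖X k ω‖ ≤ L

/-- The partial product `(I + A_m / n) (I + A_{m-1} / n) ⋯ (I + A_1 / n)`. -/
noncomputable def partialProd {𝕜 : Type*} [RCLike 𝕜] {d : ℕ}
    (A : ℤ → Matrix (Fin d) (Fin d) 𝕜) (n : ℕ) : ℕ → Matrix (Fin d) (Fin d) 𝕜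
  | 0 => 1
  | m + 1 => (1 + (n : 𝕜)⁻¹ • A ((m : ℤ) + 1)) * partialProd A n m

/-- `Z_n = (I + A_n / n) (I + A_{n-1} / n) ⋯ (I + A_1 / n)`. -/
noncomputable def normalizedProd {𝕜 : Type*} [RCLike 𝕜] {d : ℕ}
    (A : ℤ → Matrix (Fin d) (Fin d) 𝕜) (n : ℕ) : Matrix (Fin d) (Fin d) 𝕜 :=
  partialProd A n n

/-- `max {3, ⌈L e²⌉} ≤ log n + 1 ≤ (16 n / (log (d / δ) + log (n e))) ^ (1/3)`. -/
def Admissible (L : ℝ) (n d : ℕ) (δ : ℝ) : Prop :=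
  ((max 3 ⌈L * Real.exp 1 ^ 2⌉ : ℤ) : ℝ) ≤ Real.log n + 1 ∧
  Real.log n + 1 ≤
    (16 * n / (Real.log (d / δ) + Real.log (n * Real.exp 1))) ^ (1 / 3 : ℝ)

/-! Write B = I + M/n. The error Z_n - e^M splits into a fluctuation Z_n - B^n and a bias B^n - e^M.
The bias is deterministic, of size at most L²e^L/(2n), because e^M = (e^{M/n})^n and nth powers of
nearby elements are close (`norm_one_add_smul_pow_sub_exp_le`).

The fluctuation is the endpoint of the martingale Y_m = B^{n-m} Z_m - B^n, which replaces mean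
factors by random ones one at a time; its increments are bounded by c = 2Le^L/n. A matrix Azuma
inequality (`measureReal_le_norm_le_exp_sq`) then gives Gaussian tails with only a factor d in
front.

That inequality is proved by following E tr cosh of the Hermitian dilation of Y_m. Along a segment S
+ tD the function f = tr cosh satisfies f'' ≤ 2‖D‖² f, so comparison with the hyperbolic ODE yields
`Matrix.IsHermitian.traceCosh_add_le`: a factor cosh(√2 c) ≤ e^{c²}, plus a term linear in D that
averages to zero. Truncating cosh to a polynomial keeps the derivatives and integrals elementary
until the final limit. -/

/-! ### Trace inequalities for Hermitian matrices -/

section TraceInequalities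

open scoped Matrix

variable {𝕜 ι : Type*} [RCLike 𝕜] [Fintype ι] [DecidableEq ι]

theorem Matrix.sum_norm_sq_row_le (A : Matrix ι ι 𝕜) (i : ι) :
    ∑ j, ‖A i j‖ ^ 2 ≤ ‖A‖ ^ 2 := by
  have h := Aᴴ.l2_opNorm_mulVec (EuclideanSpace.single i (1 : 𝕜))
  rw [Matrix.l2_opNorm_conjTranspose] at h
  have h2 := pow_le_pow_left₀ (norm_nonneg _) h 2
  rw [EuclideanSpace.norm_sq_eq] at h2
  simpa using h2

theorem Matrix.trace_mul_eq_sum {κ : Type*} [Fintype κ] (A B : Matrix κ κ 𝕜) :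
    (A * B).trace = ∑ a, ∑ b, A a b * B b a := by
  simp only [Matrix.trace, Matrix.diag_apply, Matrix.mul_apply]

theorem Matrix.norm_unitary_conj_le {U D : Matrix ι ι 𝕜} (hU : U ∈ Matrix.unitaryGroup ι 𝕜) :
    ‖star U * D * U‖ ≤ ‖D‖ := by
  rw [CStarRing.norm_mul_mem_unitary _ hU, CStarRing.norm_mem_unitary_mul _ (Unitary.star_mem hU)]

theorem pow_mul_pow_le_add_of_even {x y : ℝ} {j l : ℕ} (h : Even (j + l)) :
    x ^ j * y ^ l ≤ x ^ (j + l) + y ^ (j + l) := by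
  have hx : x ^ (j + l) = |x| ^ (j + l) := (h.pow_abs x).symm
  have hy : y ^ (j + l) = |y| ^ (j + l) := (h.pow_abs y).symm
  have h1 : x ^ j * y ^ l ≤ |x| ^ j * |y| ^ l := by
    rw [← abs_pow, ← abs_pow, ← abs_mul]; exact le_abs_self _
  rw [hx, hy]
  refine h1.trans ?_
  rcases le_total |x| |y| with hxy | hxy
  · have : |x| ^ j * |y| ^ l ≤ |y| ^ j * |y| ^ l := by gcongr
    rw [← pow_add] at this
    have : 0 ≤ |x| ^ (j + l) := by positivity
    linarith
  · have : |x| ^ j * |y| ^ l ≤ |x| ^ j * |x| ^ l := by gcongr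
    rw [← pow_add] at this
    have : 0 ≤ |y| ^ (j + l) := by positivity
    linarith

/-- A unitary diagonalization of a Hermitian matrix, with all powers diagonalized at once. -/
theorem Matrix.IsHermitian.exists_unitary_pow {A : Matrix ι ι 𝕜} (hA : A.IsHermitian) :
    ∃ U ∈ Matrix.unitaryGroup ι 𝕜, ∃ lam : ι → ℝ, ∀ k : ℕ,
      A ^ k = U * Matrix.diagonal (fun i => ((lam i ^ k : ℝ) : 𝕜)) * star U := by
  refine ⟨hA.eigenvectorUnitary, hA.eigenvectorUnitary.2, hA.eigenvalues, fun k => ?_⟩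
  have h := hA.spectral_theorem
  conv_lhs => rw [h]
  rw [← map_pow, Matrix.diagonal_pow, Unitary.conjStarAlgAut_apply]
  congr 3
  funext i
  simp

theorem Matrix.IsHermitian.exists_eigenvalues {A : Matrix ι ι 𝕜} (hA : A.IsHermitian) :
    ∃ lam : ι → ℝ, ‖A‖ = ‖lam‖ ∧ ∀ k : ℕ, RCLike.re (A ^ k).trace = ∑ i, lam i ^ k := by
  obtain ⟨U, hU, lam, h⟩ := hA.exists_unitary_pow
  refine ⟨lam, ?_, fun k => ?_⟩
  · have h1 := h 1
    simp only [pow_one] at h1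
    rw [h1, CStarRing.norm_mul_mem_unitary _ (Unitary.star_mem hU), CStarRing.norm_mem_unitary_mul _ hU,
      Matrix.l2_opNorm_diagonal]
    simp [Pi.norm_def, nnnorm]
  · rw [h, Matrix.trace_mul_comm, ← mul_assoc, (Unitary.mem_iff.mp hU).1, one_mul,
      Matrix.trace_diagonal]
    simp only [map_sum, RCLike.ofReal_re]

theorem Matrix.IsHermitian.re_trace_pow_nonneg {A : Matrix ι ι 𝕜} (hA : A.IsHermitian) {m : ℕ}
    (hm : Even m) : 0 ≤ RCLike.re (A ^ m).trace := by
  obtain ⟨lam, -, h⟩ := hA.exists_eigenvalues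
  rw [h]
  exact Finset.sum_nonneg fun i _ => hm.pow_nonneg _

theorem Matrix.IsHermitian.norm_pow_le_re_trace {A : Matrix ι ι 𝕜} [Nonempty ι]
    (hA : A.IsHermitian) {m : ℕ} (hm : Even m) : ‖A‖ ^ m ≤ RCLike.re (A ^ m).trace := by
  obtain ⟨lam, hn, h⟩ := hA.exists_eigenvalues
  obtain ⟨i, hi⟩ := Finite.exists_max (fun i => ‖lam i‖)
  have : ‖lam‖ = ‖lam i‖ :=
    le_antisymm ((pi_norm_le_iff_of_nonneg (norm_nonneg _)).2 hi) (norm_le_pi_norm _ _)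
  rw [h, hn, this, Real.norm_eq_abs, hm.pow_abs]
  exact Finset.single_le_sum (f := fun i => lam i ^ m) (fun i _ => hm.pow_nonneg _)
    (Finset.mem_univ i)

/-- In an eigenbasis of A the trace becomes ∑ |E_ab|² λ_b^j λ_a^l, with E the conjugate of D.
Bounding each mixed product by the sum of two pure even powers leaves row sums of |E_ab|², which are
at most c². This crude split costs the factor 2, the source of √2 later on. -/
theorem Matrix.IsHermitian.re_trace_mul_pow_mul_pow_le {A D : Matrix ι ι 𝕜} (hA : A.IsHermitian)
    (hD : D.IsHermitian) {c : ℝ} (hc : ‖D‖ ≤ c) {j l : ℕ} (h : Even (j + l)) :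
    RCLike.re (D * A ^ j * (D * A ^ l)).trace ≤ 2 * c ^ 2 * RCLike.re (A ^ (j + l)).trace := by
  obtain ⟨U, hU, lam, hk⟩ := hA.exists_unitary_pow
  have hUU : star U * U = 1 := (Unitary.mem_iff.mp hU).1
  set E := star U * D * U with hE
  have hEc : ‖E‖ ≤ c := (Matrix.norm_unitary_conj_le hU).trans hc
  have hEh : ∀ a b, E b a = star (E a b) := by
    have : E.IsHermitian := by
      simpa [hE, Matrix.star_eq_conjTranspose] using Matrix.isHermitian_conjTranspose_mul_mul U hD
    exact fun a b => (this.apply b a).symm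
  have hrow : ∀ a, ∑ b, ‖E a b‖ ^ 2 ≤ c ^ 2 := fun a =>
    (E.sum_norm_sq_row_le a).trans (pow_le_pow_left₀ (norm_nonneg _) hEc 2)
  have hT : RCLike.re (A ^ (j + l)).trace = ∑ i, lam i ^ (j + l) := by
    rw [hk, Matrix.trace_mul_comm, ← mul_assoc, hUU, one_mul, Matrix.trace_diagonal]
    simp only [map_sum, RCLike.ofReal_re]
  have hL : (D * A ^ j * (D * A ^ l)).trace
      = (E * Matrix.diagonal (fun i => ((lam i ^ j : ℝ) : 𝕜)) *
        (E * Matrix.diagonal (fun i => ((lam i ^ l : ℝ) : 𝕜)))).trace := by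
    rw [hk j, hk l]
    simp only [hE, ← mul_assoc]
    rw [Matrix.trace_mul_comm]
    simp only [← mul_assoc]
  have hL2 : RCLike.re (D * A ^ j * (D * A ^ l)).trace
      = ∑ a, ∑ b, ‖E a b‖ ^ 2 * (lam b ^ j * lam a ^ l) := by
    rw [hL]
    rw [Matrix.trace_mul_eq_sum]
    simp only [map_sum]
    refine Finset.sum_congr rfl fun a _ => Finset.sum_congr rfl fun b _ => ?_
    rw [Matrix.mul_diagonal, Matrix.mul_diagonal, hEh a b]
    have : E a b * ((lam b ^ j : ℝ) : 𝕜) * (star (E a b) * ((lam a ^ l : ℝ) : 𝕜))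
        = ((‖E a b‖ ^ 2 * (lam b ^ j * lam a ^ l) : ℝ) : 𝕜) := by
      have h0 : E a b * star (E a b) = ((‖E a b‖ ^ 2 : ℝ) : 𝕜) := by
        rw [RCLike.star_def, RCLike.mul_conj]; norm_cast
      rw [RCLike.ofReal_mul, ← h0, RCLike.ofReal_mul]
      ring
    rw [this, RCLike.ofReal_re]
  rw [hL2, hT]
  have hp : ∀ a, 0 ≤ lam a ^ (j + l) := fun a => h.pow_nonneg _
  -- Since |E_ab| is symmetric, column sums obey the row-sum bound.
  have hsymm : ∑ a, ∑ b, ‖E a b‖ ^ 2 * lam b ^ (j + l)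
      = ∑ a, ∑ b, ‖E a b‖ ^ 2 * lam a ^ (j + l) := by
    rw [Finset.sum_comm]
    refine Finset.sum_congr rfl fun a _ => Finset.sum_congr rfl fun b _ => ?_
    rw [hEh a b, norm_star]
  have hbd : ∑ a, ∑ b, ‖E a b‖ ^ 2 * lam a ^ (j + l) ≤ c ^ 2 * ∑ a, lam a ^ (j + l) := by
    rw [Finset.mul_sum]
    refine Finset.sum_le_sum fun a _ => ?_
    rw [← Finset.sum_mul]
    exact mul_le_mul_of_nonneg_right (hrow a) (hp a)
  calc ∑ a, ∑ b, ‖E a b‖ ^ 2 * (lam b ^ j * lam a ^ l)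
      ≤ ∑ a, ∑ b, ‖E a b‖ ^ 2 * (lam b ^ (j + l) + lam a ^ (j + l)) := by
        gcongr
        exact pow_mul_pow_le_add_of_even h
    _ = ∑ a, ∑ b, ‖E a b‖ ^ 2 * lam b ^ (j + l) + ∑ a, ∑ b, ‖E a b‖ ^ 2 * lam a ^ (j + l) := by
        simp only [mul_add, Finset.sum_add_distrib]
    _ ≤ 2 * c ^ 2 * ∑ i, lam i ^ (j + l) := by rw [hsymm]; linarith

end TraceInequalities

/-! ### Truncated trace-cosh and its second-order differential inequality -/

section TraceCosh

open scoped Matrix Nat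

variable {𝕜 ι : Type*} [RCLike 𝕜] [Fintype ι] [DecidableEq ι]

/-- The noncommutative Leibniz rule for powers; the parameter is real, so the real structure is
obtained by restricting scalars. -/
theorem hasDerivAt_re_apply_mul_pow {𝔸 : Type*} [NormedRing 𝔸] [NormedAlgebra 𝕜 𝔸]
    (T : 𝔸 →L[𝕜] 𝕜) (B S D : 𝔸) (m : ℕ) (t : ℝ) :
    HasDerivAt (fun s : ℝ => RCLike.re (T (B * (S + (s : 𝕜) • D) ^ m)))
      (∑ i ∈ Finset.range m, RCLike.re
        (T (B * (S + (t : 𝕜) • D) ^ (m - 1 - i) * (D * (S + (t : 𝕜) • D) ^ i)))) t := by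
  let _ : NormedAlgebra ℝ 𝔸 := NormedAlgebra.restrictScalars ℝ 𝕜 𝔸
  have : IsScalarTower ℝ 𝕜 𝔸 := .of_algebraMap_smul fun _ _ => rfl
  have h1 : HasDerivAt (fun s : ℝ => S + (s : 𝕜) • D) D t := by
    have : HasDerivAt (fun s : ℝ => S + s • D) D t := by
      simpa using ((hasDerivAt_id t).smul_const D).const_add S
    exact this
  have h2 := (RCLike.reCLM.comp (T.restrictScalars ℝ)).hasFDerivAt.comp_hasDerivAt t
    ((h1.fun_pow' m).const_mul B)
  refine h2.congr_deriv ?_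
  rw [Finset.mul_sum, map_sum]
  refine Finset.sum_congr rfl fun i _ => ?_
  simp only [Nat.pred_eq_sub_one, ← mul_assoc]
  rfl

theorem hasDerivAt_re_trace_mul_pow (B S D : Matrix ι ι 𝕜) (m : ℕ) (t : ℝ) :
    HasDerivAt (fun s : ℝ => RCLike.re (B * (S + (s : 𝕜) • D) ^ m).trace)
      (∑ i ∈ Finset.range m, RCLike.re
        (B * (S + (t : 𝕜) • D) ^ (m - 1 - i) * (D * (S + (t : 𝕜) • D) ^ i)).trace) t :=
  hasDerivAt_re_apply_mul_pow
    (⟨Matrix.traceLinearMap ι 𝕜 𝕜, continuous_id.matrix_trace⟩ : Matrix ι ι 𝕜 →L[𝕜] 𝕜) B S D m t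

/-- The partial sums of the power series of `tr cosh A`. -/
noncomputable def traceCosh (N : ℕ) (A : Matrix ι ι 𝕜) : ℝ :=
  ∑ p ∈ Finset.range (N + 1), RCLike.re (A ^ (2 * p)).trace / (2 * p)!

/-- The derivative of `traceCosh N` at `A` in the direction `D`. -/
noncomputable def traceSinh (N : ℕ) (A D : Matrix ι ι 𝕜) : ℝ :=
  ∑ p ∈ Finset.range N, RCLike.re (D * A ^ (2 * p + 1)).trace / (2 * p + 1)!

/-- Cyclicity of the trace makes all 2p Leibniz terms equal, and the factor 2p turns (2p)! into
(2p-1)!. The constant term p = 0 drops out. -/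
theorem hasDerivAt_traceCosh (N : ℕ) (S D : Matrix ι ι 𝕜) (t : ℝ) :
    HasDerivAt (fun s : ℝ => traceCosh N (S + (s : 𝕜) • D))
      (traceSinh N (S + (t : 𝕜) • D) D) t := by
  unfold traceCosh traceSinh
  have h : ∀ p, HasDerivAt
      (fun s : ℝ => RCLike.re ((S + (s : 𝕜) • D) ^ (2 * p)).trace / (2 * p)!)
      ((2 * p : ℕ) * RCLike.re (D * (S + (t : 𝕜) • D) ^ (2 * p - 1)).trace / (2 * p)!) t := by
    intro p
    have := hasDerivAt_re_trace_mul_pow 1 S D (2 * p) t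
    simp only [one_mul] at this
    refine (this.div_const _).congr_deriv ?_
    congr 1
    rw [Finset.sum_congr rfl (g := fun _ =>
      RCLike.re (D * (S + (t : 𝕜) • D) ^ (2 * p - 1)).trace), Finset.sum_const, Finset.card_range,
      nsmul_eq_mul]
    intro i hi
    rw [Finset.mem_range] at hi
    rw [Matrix.trace_mul_comm, mul_assoc, ← pow_add]
    congr 5
    omega
  refine (HasDerivAt.fun_sum fun p (_ : p ∈ Finset.range (N + 1)) => h p).congr_deriv ?_
  rw [Finset.sum_range_succ']
  simp only [mul_zero, Nat.cast_zero, zero_mul, zero_div, add_zero]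
  refine Finset.sum_congr rfl fun p _ => ?_
  have e : 2 * (p + 1) = 2 * p + 1 + 1 := by ring
  rw [e, Nat.factorial_succ, Nat.cast_mul, add_tsub_cancel_right, mul_div_mul_left]
  positivity

theorem hasDerivAt_traceSinh (N : ℕ) (S D : Matrix ι ι 𝕜) (t : ℝ) :
    HasDerivAt (fun s : ℝ => traceSinh N (S + (s : 𝕜) • D) D)
      (∑ p ∈ Finset.range N, (∑ i ∈ Finset.range (2 * p + 1), RCLike.re
        (D * (S + (t : 𝕜) • D) ^ (2 * p - i) * (D * (S + (t : 𝕜) • D) ^ i)).trace)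
          / (2 * p + 1)!) t := by
  unfold traceSinh
  refine HasDerivAt.fun_sum fun p _ => ?_
  simpa using (hasDerivAt_re_trace_mul_pow D S D (2 * p + 1) t).div_const ((2 * p + 1)! : ℝ)

/-- With D occurring twice the Leibniz terms no longer coincide, but each of the 2p+1 is at most 2c²
tr A^{2p}, and the count cancels against (2p+1)!. The nonnegative top term of the truncated cosh is
to spare. -/
theorem Matrix.IsHermitian.traceSinh_deriv_le {A D : Matrix ι ι 𝕜} (hA : A.IsHermitian)
    (hD : D.IsHermitian) {c : ℝ} (hc : ‖D‖ ≤ c) (N : ℕ) :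
    ∑ p ∈ Finset.range N, (∑ i ∈ Finset.range (2 * p + 1), RCLike.re
        (D * A ^ (2 * p - i) * (D * A ^ i)).trace) / (2 * p + 1)! ≤ 2 * c ^ 2 * traceCosh N A := by
  have hnn : ∀ p, 0 ≤ RCLike.re (A ^ (2 * p)).trace / ((2 * p)! : ℝ) := fun p =>
    div_nonneg (hA.re_trace_pow_nonneg (even_two_mul p)) (by positivity)
  have hterm : ∀ p, (∑ i ∈ Finset.range (2 * p + 1), RCLike.re
        (D * A ^ (2 * p - i) * (D * A ^ i)).trace) / ((2 * p + 1)! : ℝ)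
        ≤ 2 * c ^ 2 * (RCLike.re (A ^ (2 * p)).trace / ((2 * p)! : ℝ)) := by
    intro p
    have h1 : ∑ i ∈ Finset.range (2 * p + 1), RCLike.re
        (D * A ^ (2 * p - i) * (D * A ^ i)).trace
        ≤ ((2 * p + 1 : ℕ) : ℝ) * (2 * c ^ 2 * RCLike.re (A ^ (2 * p)).trace) := by
      have := Finset.sum_le_card_nsmul (Finset.range (2 * p + 1)) (fun i => RCLike.re
        (D * A ^ (2 * p - i) * (D * A ^ i)).trace) (2 * c ^ 2 * RCLike.re (A ^ (2 * p)).trace) ?_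
      · simpa [nsmul_eq_mul] using this
      · intro i hi
        rw [Finset.mem_range] at hi
        have e : 2 * p - i + i = 2 * p := by omega
        have := hA.re_trace_mul_pow_mul_pow_le hD hc (j := 2 * p - i) (l := i)
          (by rw [e]; exact even_two_mul p)
        rwa [e] at this
    rw [div_le_iff₀ (by positivity)]
    refine h1.trans (le_of_eq ?_)
    rw [Nat.factorial_succ]
    push_cast
    field_simp
  calc _ ≤ ∑ p ∈ Finset.range N, 2 * c ^ 2 * (RCLike.re (A ^ (2 * p)).trace / ((2 * p)! : ℝ)) :=
        Finset.sum_le_sum fun p _ => hterm p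
    _ = 2 * c ^ 2 * ∑ p ∈ Finset.range N, RCLike.re (A ^ (2 * p)).trace / ((2 * p)! : ℝ) := by
        rw [Finset.mul_sum]
    _ ≤ 2 * c ^ 2 * traceCosh N A := by
        unfold traceCosh
        rw [Finset.sum_range_succ]
        have := hnn N
        gcongr
        linarith

/-- A comparison principle for the differential inequality `f'' ≤ a² f`. -/
theorem le_cosh_mul_add_sinh_mul {f f' f'' : ℝ → ℝ} {a : ℝ} (ha : 0 < a)
    (hf : ∀ t, HasDerivAt f (f' t) t) (hf' : ∀ t, HasDerivAt f' (f'' t) t)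
    (h : ∀ t, f'' t ≤ a ^ 2 * f t) :
    f 1 ≤ Real.cosh a * f 0 + Real.sinh a / a * f' 0 := by
  -- u(t) is the value at time 1 of the solution of g'' = a²g that has the data f(t), f'(t) at time
  -- t. It would be constant if f solved the equation; here it decreases.
  set u : ℝ → ℝ := fun t =>
    f t * Real.cosh (a * (1 - t)) + f' t * (Real.sinh (a * (1 - t)) / a) with hu
  have hlin : ∀ t : ℝ, HasDerivAt (fun t : ℝ => a * (1 - t)) (-a) t := fun t => by
    simpa using ((hasDerivAt_id t).const_sub 1).const_mul a
  have hd : ∀ t, HasDerivAt u (Real.sinh (a * (1 - t)) / a * (f'' t - a ^ 2 * f t)) t := by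
    intro t
    have h1 := (hf t).mul (hlin t).cosh
    have h2 := (hf' t).mul ((hlin t).sinh.div_const a)
    refine (h1.add h2).congr_deriv ?_
    field_simp
    ring
  have hanti : AntitoneOn u (Set.Icc 0 1) := by
    refine antitoneOn_of_deriv_nonpos (convex_Icc 0 1)
      (fun t _ => (hd t).continuousAt.continuousWithinAt)
      (fun t _ => (hd t).differentiableAt.differentiableWithinAt) fun t ht => ?_
    rw [interior_Icc] at ht
    rw [(hd t).deriv]
    refine mul_nonpos_of_nonneg_of_nonpos (div_nonneg (Real.sinh_nonneg_iff.2 ?_) ha.le)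
      (sub_nonpos.2 (h t))
    exact mul_nonneg ha.le (sub_nonneg.2 ht.2.le)
  have := hanti (Set.left_mem_Icc.2 zero_le_one) (Set.right_mem_Icc.2 zero_le_one) zero_le_one
  simp only [hu, sub_self, mul_zero, Real.cosh_zero, Real.sinh_zero, zero_div, sub_zero,
    mul_one, add_zero] at this
  linarith

theorem Matrix.IsHermitian.traceCosh_add_le {S D : Matrix ι ι 𝕜} (hS : S.IsHermitian)
    (hD : D.IsHermitian) {c : ℝ} (hc0 : 0 < c) (hc : ‖D‖ ≤ c) (N : ℕ) :
    traceCosh N (S + D) ≤ Real.cosh (√2 * c) * traceCosh N S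
      + Real.sinh (√2 * c) / (√2 * c) * traceSinh N S D := by
  have hH : ∀ t : ℝ, (S + (t : 𝕜) • D).IsHermitian := fun t => by
    refine hS.add ?_
    rw [Matrix.IsHermitian, Matrix.conjTranspose_smul, hD.eq]
    simp
  have := le_cosh_mul_add_sinh_mul (a := √2 * c) (by positivity)
    (fun t => hasDerivAt_traceCosh N S D t) (fun t => hasDerivAt_traceSinh N S D t)
    (fun t => by
      rw [mul_pow, Real.sq_sqrt (by norm_num)]
      exact (hH t).traceSinh_deriv_le hD hc N)
  simpa using this

end TraceCosh

/-! ### Hermitian dilation -/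

section Dilation

open scoped Matrix

variable {𝕜 ι : Type*} [RCLike 𝕜]

/-- The Hermitian dilation of a square matrix. -/
def hermitianDilation (T : Matrix ι ι 𝕜) : Matrix (ι ⊕ ι) (ι ⊕ ι) 𝕜 :=
  Matrix.fromBlocks 0 T Tᴴ 0

theorem isHermitian_hermitianDilation (T : Matrix ι ι 𝕜) : (hermitianDilation T).IsHermitian := by
  simp [hermitianDilation, Matrix.IsHermitian, Matrix.fromBlocks_conjTranspose]

theorem hermitianDilation_add (S T : Matrix ι ι 𝕜) :
    hermitianDilation (S + T) = hermitianDilation S + hermitianDilation T := by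
  simp [hermitianDilation, Matrix.fromBlocks_add]

theorem continuous_hermitianDilation :
    Continuous (hermitianDilation : Matrix ι ι 𝕜 → Matrix (ι ⊕ ι) (ι ⊕ ι) 𝕜) :=
  Continuous.matrix_fromBlocks continuous_const continuous_id continuous_id.matrix_conjTranspose
    continuous_const

variable [Fintype ι] [DecidableEq ι]

theorem norm_sq_mulVec_le (A : Matrix ι ι 𝕜) (v : ι → 𝕜) :
    ∑ i, ‖(A *ᵥ v) i‖ ^ 2 ≤ ‖A‖ ^ 2 * ∑ i, ‖v i‖ ^ 2 := by
  have h := A.l2_opNorm_mulVec (WithLp.toLp 2 v)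
  have h2 := pow_le_pow_left₀ (norm_nonneg _) h 2
  rw [mul_pow, EuclideanSpace.norm_sq_eq, EuclideanSpace.norm_sq_eq] at h2
  simpa using h2

theorem Matrix.l2_opNorm_le_of_forall {A : Matrix ι ι 𝕜} {c : ℝ} (hc : 0 ≤ c)
    (h : ∀ v : ι → 𝕜, ∑ i, ‖(A *ᵥ v) i‖ ^ 2 ≤ c ^ 2 * ∑ i, ‖v i‖ ^ 2) : ‖A‖ ≤ c := by
  rw [← Matrix.l2_opNorm_toEuclideanCLM]
  refine ContinuousLinearMap.opNorm_le_bound _ hc fun x => ?_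
  refine (sq_le_sq₀ (norm_nonneg _) (by positivity)).mp ?_
  rw [mul_pow, EuclideanSpace.norm_sq_eq, EuclideanSpace.norm_sq_eq]
  simpa using h x.ofLp

theorem norm_hermitianDilation (T : Matrix ι ι 𝕜) : ‖hermitianDilation T‖ = ‖T‖ := by
  apply le_antisymm
  · refine Matrix.l2_opNorm_le_of_forall (norm_nonneg _) fun v => ?_
    rw [hermitianDilation, Matrix.fromBlocks_mulVec]
    simp only [Fintype.sum_sum_type, Sum.elim_inl, Sum.elim_inr, Matrix.zero_mulVec, zero_add,
      add_zero]
    have h1 := norm_sq_mulVec_le T (v ∘ Sum.inr)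
    have h2 := norm_sq_mulVec_le Tᴴ (v ∘ Sum.inl)
    rw [Matrix.l2_opNorm_conjTranspose] at h2
    simp only [Function.comp_apply] at h1 h2
    linarith
  · refine Matrix.l2_opNorm_le_of_forall (norm_nonneg _) fun v => ?_
    have := norm_sq_mulVec_le (hermitianDilation T) (Sum.elim 0 v)
    nth_rw 1 [hermitianDilation] at this
    rw [Matrix.fromBlocks_mulVec] at this
    simpa [Fintype.sum_sum_type] using this

/-- A trace and that of its adjoint have equal real parts, so the Dᴴ block can be traded for D.
Hence the first-order term is linear in the undilated increment, where orthogonality applies. -/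
theorem re_trace_hermitianDilation_mul (D : Matrix ι ι 𝕜) (Q : Matrix (ι ⊕ ι) (ι ⊕ ι) 𝕜) :
    RCLike.re (hermitianDilation D * Q).trace
      = RCLike.re (D * (Q.toBlocks₂₁ + Q.toBlocks₁₂ᴴ)).trace := by
  conv_lhs => rw [← Matrix.fromBlocks_toBlocks Q]
  rw [hermitianDilation, Matrix.fromBlocks_multiply, Matrix.trace]
  simp only [Fintype.sum_sum_type, Matrix.diag_apply, Matrix.fromBlocks_apply₁₁,
    Matrix.fromBlocks_apply₂₂, zero_mul, zero_add, add_zero, mul_add, Matrix.trace_add, map_add]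
  change RCLike.re (D * Q.toBlocks₂₁).trace + RCLike.re (Dᴴ * Q.toBlocks₁₂).trace = _
  congr 1
  rw [Matrix.trace_mul_comm D, ← RCLike.conj_re, ← RCLike.star_def, ← Matrix.trace_conjTranspose,
    Matrix.conjTranspose_mul, Matrix.conjTranspose_conjTranspose]

end Dilation

/-! ### Matrix Azuma inequality -/

section Martingale

open scoped Matrix Nat

variable {𝕜 ι : Type*} [RCLike 𝕜] [Fintype ι] [DecidableEq ι]

theorem continuous_traceCosh (N : ℕ) :
    Continuous (traceCosh N : Matrix ι ι 𝕜 → ℝ) := by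
  unfold traceCosh
  refine continuous_finsetSum _ fun p _ => ?_
  exact (RCLike.continuous_re.comp (continuous_id.pow (2 * p)).matrix_trace).div_const _

theorem traceSinh_eq (N : ℕ) (A D : Matrix ι ι 𝕜) :
    traceSinh N A D = RCLike.re
      (D * ∑ p ∈ Finset.range N, (((2 * p + 1)! : ℝ)⁻¹ : 𝕜) • A ^ (2 * p + 1)).trace := by
  unfold traceSinh
  rw [Finset.mul_sum, Matrix.trace_sum, map_sum]
  refine Finset.sum_congr rfl fun p _ => ?_
  rw [Matrix.mul_smul, Matrix.trace_smul, smul_eq_mul, ← RCLike.ofReal_inv, RCLike.re_ofReal_mul,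
    div_eq_inv_mul]

theorem exists_continuous_traceSinh_hermitianDilation (N : ℕ) :
    ∃ W : Matrix ι ι 𝕜 → Matrix ι ι 𝕜, Continuous W ∧ ∀ S D,
      traceSinh N (hermitianDilation S) (hermitianDilation D) = RCLike.re (D * W S).trace := by
  set Q : Matrix ι ι 𝕜 → Matrix (ι ⊕ ι) (ι ⊕ ι) 𝕜 := fun S => ∑ p ∈ Finset.range N,
    (((2 * p + 1)! : ℝ)⁻¹ : 𝕜) • hermitianDilation S ^ (2 * p + 1) with hQ
  have hQc : Continuous Q := continuous_finsetSum _ fun p _ =>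
    (continuous_hermitianDilation.fun_pow _).fun_const_smul _
  refine ⟨fun S => (Q S).toBlocks₂₁ + (Q S).toBlocks₁₂ᴴ, ?_, fun S D => ?_⟩
  · refine Continuous.add ?_ (Continuous.matrix_conjTranspose ?_)
    · exact continuous_matrix fun i j => hQc.matrix_elem _ _
    · exact continuous_matrix fun i j => hQc.matrix_elem _ _
  · rw [traceSinh_eq, re_trace_hermitianDilation_mul]

variable {Ω : Type*} [MeasurableSpace Ω] {P : Measure Ω} [IsProbabilityMeasure P]

theorem integrable_comp_of_bounded {E F : Type*} [NormedAddCommGroup E] [ProperSpace E]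
    [NormedAddCommGroup F] {f : E → F}
    (hf : Continuous f) {Z : Ω → E} (hZ : AEStronglyMeasurable Z P) {R : ℝ}
    (hR : ∀ᵐ ω ∂P, ‖Z ω‖ ≤ R) : Integrable (fun ω => f (Z ω)) P := by
  obtain ⟨C, hC⟩ := (isCompact_closedBall (0 : E) R).exists_bound_of_continuousOn hf.continuousOn
  refine Integrable.of_bound (hf.comp_aestronglyMeasurable hZ) C ?_
  filter_upwards [hR] with ω hω
  exact hC _ (by simpa using hω)

/-- A bound for the exponential moments of a matrix martingale with bounded increments. The
martingale property enters as orthogonality of increments to functions of the past. -/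
theorem integral_traceCosh_hermitianDilation_le {Y : ℕ → Ω → Matrix ι ι 𝕜} {n : ℕ} {c : ℝ}
    (hc : 0 < c) (hY : ∀ m, AEStronglyMeasurable (Y m) P) (h0 : ∀ ω, Y 0 ω = 0)
    (hstep : ∀ m < n, ∀ᵐ ω ∂P, ‖Y (m + 1) ω - Y m ω‖ ≤ c)
    (horth : ∀ m < n, ∀ W : Matrix ι ι 𝕜 → Matrix ι ι 𝕜, Continuous W →
      ∫ ω, RCLike.re ((Y (m + 1) ω - Y m ω) * W (Y m ω)).trace ∂P = 0) (N : ℕ) :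
    ∀ m ≤ n, Integrable (fun ω => traceCosh N (hermitianDilation (Y m ω))) P ∧
      ∫ ω, traceCosh N (hermitianDilation (Y m ω)) ∂P
        ≤ Real.exp (m * c ^ 2) * (2 * Fintype.card ι) := by
  have : ProperSpace (Matrix ι ι 𝕜) := FiniteDimensional.proper 𝕜 _
  have hbound : ∀ m ≤ n, ∀ᵐ ω ∂P, ‖Y m ω‖ ≤ m * c := by
    intro m
    induction m with
    | zero => intro _; simp [h0]
    | succ m ih =>
      intro hm
      filter_upwards [ih (by omega), hstep m (by omega)] with ω h1 h2
      have := norm_add_le (Y (m + 1) ω - Y m ω) (Y m ω)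
      rw [sub_add_cancel] at this
      push_cast
      linarith
  have hint : ∀ m ≤ n, Integrable (fun ω => traceCosh N (hermitianDilation (Y m ω))) P :=
    fun m hm => integrable_comp_of_bounded
      ((continuous_traceCosh N).comp continuous_hermitianDilation) (hY m) (hbound m hm)
  intro m
  induction m with
  | zero =>
    intro hm
    refine ⟨hint 0 hm, ?_⟩
    have hz : hermitianDilation (0 : Matrix ι ι 𝕜) = 0 := by simp [hermitianDilation]
    have h1 : traceCosh N (0 : Matrix (ι ⊕ ι) (ι ⊕ ι) 𝕜) = 2 * Fintype.card ι := by
      unfold traceCosh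
      rw [Finset.sum_range_succ']
      simp [two_mul]
    simp [h0, hz, h1]
  | succ m ih =>
    intro hm
    refine ⟨hint _ hm, ?_⟩
    obtain ⟨W, hWc, hW⟩ := exists_continuous_traceSinh_hermitianDilation (𝕜 := 𝕜) (ι := ι) N
    have hi2 : Integrable (fun ω => RCLike.re ((Y (m + 1) ω - Y m ω) * W (Y m ω)).trace) P := by
      refine integrable_comp_of_bounded (Z := fun ω => (Y (m + 1) ω, Y m ω))
        (f := fun z : Matrix ι ι 𝕜 × Matrix ι ι 𝕜 => RCLike.re ((z.1 - z.2) * W z.2).trace)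
        (R := max ((m + 1 : ℕ) * c) (m * c)) ?_ ((hY _).prodMk (hY _)) ?_
      · exact RCLike.continuous_re.comp
          ((continuous_fst.sub continuous_snd).mul (hWc.comp continuous_snd)).matrix_trace
      · filter_upwards [hbound _ hm, hbound m (by omega)] with ω h1 h2
        exact max_le_max h1 h2
    have hpt : ∀ᵐ ω ∂P, traceCosh N (hermitianDilation (Y (m + 1) ω)) ≤
        Real.cosh (√2 * c) * traceCosh N (hermitianDilation (Y m ω))
          + Real.sinh (√2 * c) / (√2 * c) *
            RCLike.re ((Y (m + 1) ω - Y m ω) * W (Y m ω)).trace := by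
      filter_upwards [hstep m (by omega)] with ω hω
      have := (isHermitian_hermitianDilation (Y m ω)).traceCosh_add_le
        (isHermitian_hermitianDilation (Y (m + 1) ω - Y m ω)) hc
        ((norm_hermitianDilation _).trans_le hω) N
      rwa [← hermitianDilation_add, add_sub_cancel, hW] at this
    -- From cosh x ≤ e^{x²/2}.
    have hcosh : Real.cosh (√2 * c) ≤ Real.exp (c ^ 2) := by
      refine (Real.cosh_le_exp_half_sq _).trans_eq ?_
      rw [mul_pow, Real.sq_sqrt (by norm_num)]
      congr 1
      ring
    calc ∫ ω, traceCosh N (hermitianDilation (Y (m + 1) ω)) ∂P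
        ≤ ∫ ω, (Real.cosh (√2 * c) * traceCosh N (hermitianDilation (Y m ω))
          + Real.sinh (√2 * c) / (√2 * c) *
            RCLike.re ((Y (m + 1) ω - Y m ω) * W (Y m ω)).trace) ∂P :=
          integral_mono_ae (hint _ hm)
            (((hint m (by omega)).const_mul _).add (hi2.const_mul _)) hpt
      _ = Real.cosh (√2 * c) * ∫ ω, traceCosh N (hermitianDilation (Y m ω)) ∂P := by
          rw [integral_add ((hint m (by omega)).const_mul _) (hi2.const_mul _),
            integral_const_mul, integral_const_mul, horth m (by omega) W hWc, mul_zero, add_zero]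
      _ ≤ Real.exp (c ^ 2) * (Real.exp (m * c ^ 2) * (2 * Fintype.card ι)) := by
          have h1 := (ih (by omega)).2
          have := Real.cosh_pos (√2 * c)
          calc _ ≤ Real.cosh (√2 * c) * (Real.exp (m * c ^ 2) * (2 * Fintype.card ι)) := by gcongr
            _ ≤ _ := by gcongr
      _ = _ := by
          rw [← mul_assoc, ← Real.exp_add]
          push_cast
          ring_nf

theorem Matrix.IsHermitian.sum_norm_pow_le_traceCosh [Nonempty ι] {A : Matrix ι ι 𝕜}
    (hA : A.IsHermitian) (N : ℕ) :
    ∑ p ∈ Finset.range (N + 1), ‖A‖ ^ (2 * p) / (2 * p)! ≤ traceCosh N A := by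
  unfold traceCosh
  gcongr with p _
  exact hA.norm_pow_le_re_trace (even_two_mul p)

/-- Markov's inequality for each truncation, then N → ∞. The 4 combines the doubled dimension of the
dilation with cosh t ≥ e^t/2. -/
theorem measureReal_le_norm_le_exp [Nonempty ι] {Y : ℕ → Ω → Matrix ι ι 𝕜} {n : ℕ} {c : ℝ}
    (hc : 0 < c) (hY : ∀ m, AEStronglyMeasurable (Y m) P) (h0 : ∀ ω, Y 0 ω = 0)
    (hstep : ∀ m < n, ∀ᵐ ω ∂P, ‖Y (m + 1) ω - Y m ω‖ ≤ c)
    (horth : ∀ m < n, ∀ W : Matrix ι ι 𝕜 → Matrix ι ι 𝕜, Continuous W →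
      ∫ ω, RCLike.re ((Y (m + 1) ω - Y m ω) * W (Y m ω)).trace ∂P = 0) {t : ℝ} (ht : 0 ≤ t) :
    P.real {ω | t ≤ ‖Y n ω‖} ≤ 4 * Fintype.card ι * Real.exp (n * c ^ 2 - t) := by
  have hN : ∀ N : ℕ, (∑ p ∈ Finset.range (N + 1), t ^ (2 * p) / ((2 * p)! : ℝ)) *
      P.real {ω | t ≤ ‖Y n ω‖} ≤ Real.exp (n * c ^ 2) * (2 * Fintype.card ι) := by
    intro N
    obtain ⟨h1, h2⟩ := integral_traceCosh_hermitianDilation_le hc hY h0 hstep horth N n le_rfl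
    have hle : ∀ ω, ∑ p ∈ Finset.range (N + 1), ‖Y n ω‖ ^ (2 * p) / ((2 * p)! : ℝ)
        ≤ traceCosh N (hermitianDilation (Y n ω)) := fun ω => by
      simpa only [norm_hermitianDilation] using
        (isHermitian_hermitianDilation (Y n ω)).sum_norm_pow_le_traceCosh N
    have h3 := mul_meas_ge_le_integral_of_nonneg (μ := P)
      (f := fun ω => traceCosh N (hermitianDilation (Y n ω)))
      (Filter.Eventually.of_forall fun ω =>
        le_trans (Finset.sum_nonneg fun p _ => by positivity) (hle ω)) h1
      (∑ p ∈ Finset.range (N + 1), t ^ (2 * p) / ((2 * p)! : ℝ))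
    refine (mul_le_mul_of_nonneg_left (measureReal_mono fun ω hω => ?_)
      (Finset.sum_nonneg fun p _ => by positivity)).trans (h3.trans h2)
    refine le_trans ?_ (hle ω)
    have hω' : t ≤ ‖Y n ω‖ := hω
    gcongr
  have hlim := (((Real.hasSum_cosh t).tendsto_sum_nat.comp
    (Filter.tendsto_add_atTop_nat 1)).mul_const (P.real {ω | t ≤ ‖Y n ω‖}))
  have hfin : Real.cosh t * P.real {ω | t ≤ ‖Y n ω‖}
      ≤ Real.exp (n * c ^ 2) * (2 * Fintype.card ι) := le_of_tendsto' hlim hN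
  have hcosh : Real.exp t / 2 ≤ Real.cosh t := by
    rw [Real.cosh_eq]
    have := Real.exp_pos (-t)
    linarith
  have h4 := (mul_le_mul_of_nonneg_right hcosh
    (measureReal_nonneg (μ := P) (s := {ω | t ≤ ‖Y n ω‖}))).trans hfin
  rw [Real.exp_sub, mul_div_assoc', le_div_iff₀ (Real.exp_pos t)]
  linarith

/-- A Hoeffding–Azuma inequality for matrix martingales. -/
theorem measureReal_le_norm_le_exp_sq [Nonempty ι] {Y : ℕ → Ω → Matrix ι ι 𝕜} {n : ℕ} (hn : 0 < n)
    {c : ℝ} (hc : 0 < c) (hY : ∀ m, AEStronglyMeasurable (Y m) P) (h0 : ∀ ω, Y 0 ω = 0)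
    (hstep : ∀ m < n, ∀ᵐ ω ∂P, ‖Y (m + 1) ω - Y m ω‖ ≤ c)
    (horth : ∀ m < n, ∀ W : Matrix ι ι 𝕜 → Matrix ι ι 𝕜, Continuous W →
      ∫ ω, RCLike.re ((Y (m + 1) ω - Y m ω) * W (Y m ω)).trace ∂P = 0) {t : ℝ} (ht : 0 < t) :
    P.real {ω | t ≤ ‖Y n ω‖}
      ≤ 4 * Fintype.card ι * Real.exp (-(t ^ 2 / (4 * n * c ^ 2))) := by
  have hn' : (0 : ℝ) < n := by exact_mod_cast hn
  -- The minimizer of nθ²c² - θt, the exponent obtained for the rescaled martingale θY.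
  set θ : ℝ := t / (2 * n * c ^ 2) with hθ
  have hθ0 : 0 < θ := by positivity
  have hnorm : ∀ A : Matrix ι ι 𝕜, ‖(θ : 𝕜) • A‖ = θ * ‖A‖ := fun A => by
    rw [norm_smul, RCLike.norm_of_nonneg hθ0.le]
  have key := measureReal_le_norm_le_exp (P := P) (Y := fun m ω => (θ : 𝕜) • Y m ω) (n := n)
    (c := θ * c) (t := θ * t) (by positivity) (fun m => (hY m).fun_const_smul _)
    (fun ω => by simp [h0])
    (fun m hm => by
      filter_upwards [hstep m hm] with ω hω
      rw [← smul_sub, hnorm]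
      gcongr)
    (fun m hm W hW => by
      have := horth m hm (fun A => W ((θ : 𝕜) • A)) (hW.comp (continuous_const_smul _))
      simp only [← smul_sub, Matrix.smul_mul, Matrix.trace_smul, smul_eq_mul, RCLike.re_ofReal_mul]
      rw [integral_const_mul, this, mul_zero])
    (by positivity)
  simp only [hnorm, mul_le_mul_iff_right₀ hθ0] at key
  convert key using 3
  rw [hθ]
  field_simp
  ring

end Martingale

/-! ### Norm estimates for powers and the exponential -/

section Exponential

open scoped Nat

theorem norm_pow_succ_sub_pow_succ_le {𝔸 : Type*} [NormedRing 𝔸] [NormOneClass 𝔸] {a b : 𝔸} {r : ℝ}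
    (ha : ‖a‖ ≤ r) (hb : ‖b‖ ≤ r) (n : ℕ) :
    ‖a ^ (n + 1) - b ^ (n + 1)‖ ≤ (n + 1) * r ^ n * ‖a - b‖ := by
  have hr : 0 ≤ r := (norm_nonneg a).trans ha
  induction n with
  | zero => simp
  | succ n ih =>
    have e : a ^ (n + 1 + 1) - b ^ (n + 1 + 1)
        = a ^ (n + 1) * (a - b) + (a ^ (n + 1) - b ^ (n + 1)) * b := by
      rw [pow_succ a (n + 1), pow_succ b (n + 1)]
      noncomm_ring
    have h1 : ‖a ^ (n + 1) * (a - b)‖ ≤ r ^ (n + 1) * ‖a - b‖ :=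
      (norm_mul_le _ _).trans (by
        gcongr
        exact (norm_pow_le a _).trans (pow_le_pow_left₀ (norm_nonneg _) ha _))
    have h2 : ‖(a ^ (n + 1) - b ^ (n + 1)) * b‖ ≤ (n + 1) * r ^ n * ‖a - b‖ * r :=
      (norm_mul_le _ _).trans (by gcongr)
    rw [e]
    refine (norm_add_le _ _).trans ((add_le_add h1 h2).trans_eq ?_)
    push_cast
    ring

theorem Real.hasSum_exp_series (x : ℝ) : HasSum (fun n : ℕ => x ^ n / (n ! : ℝ)) (Real.exp x) := by
  rw [Real.exp_eq_exp_ℝ]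
  exact NormedSpace.expSeries_div_hasSum_exp x

theorem norm_inv_factorial_smul_pow_le (𝕜 : Type*) {𝔸 : Type*} [RCLike 𝕜] [NormedRing 𝔸] [NormedAlgebra 𝕜 𝔸]
    [NormOneClass 𝔸] (x : 𝔸) (n : ℕ) :
    ‖((n ! : 𝕜)⁻¹) • x ^ n‖ ≤ ‖x‖ ^ n / n ! := by
  rw [norm_smul, norm_inv, RCLike.norm_natCast, div_eq_inv_mul]
  gcongr
  exact norm_pow_le x n

theorem NormedSpace.norm_exp_le_exp_norm (𝕜 : Type*) {𝔸 : Type*} [RCLike 𝕜] [NormedRing 𝔸] [NormedAlgebra 𝕜 𝔸]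
    [CompleteSpace 𝔸] [NormOneClass 𝔸] (x : 𝔸) :
    ‖NormedSpace.exp x‖ ≤ Real.exp ‖x‖ :=
  (NormedSpace.exp_series_hasSum_exp' (𝕂 := 𝕜) x).norm_le_of_bounded
    (Real.hasSum_exp_series ‖x‖) (norm_inv_factorial_smul_pow_le 𝕜 x)

/-- Termwise comparison of the tail series, using (n+2)! ≥ 2 · n!. -/
theorem NormedSpace.norm_exp_sub_one_sub_self_le (𝕜 : Type*) {𝔸 : Type*} [RCLike 𝕜] [NormedRing 𝔸] [NormedAlgebra 𝕜 𝔸]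
    [CompleteSpace 𝔸] [NormOneClass 𝔸] (x : 𝔸) :
    ‖NormedSpace.exp x - (1 + x)‖ ≤ ‖x‖ ^ 2 / 2 * Real.exp ‖x‖ := by
  have h1 := (hasSum_nat_add_iff' (f := fun n : ℕ => ((n ! : 𝕜)⁻¹) • x ^ n) 2).2
    (NormedSpace.exp_series_hasSum_exp' (𝕂 := 𝕜) x)
  have h2 := (Real.hasSum_exp_series ‖x‖).mul_left (‖x‖ ^ 2 / 2)
  have h3 := h1.norm_le_of_bounded h2 fun n => by
    refine (norm_inv_factorial_smul_pow_le 𝕜 x (n + 2)).trans ?_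
    have hf : (2 * n ! : ℝ) ≤ ((n + 2)! : ℝ) := by
      have : 2 * n ! ≤ (n + 2)! := by
        rw [Nat.factorial_succ, Nat.factorial_succ, ← mul_assoc]
        exact Nat.mul_le_mul_right _ (by nlinarith)
      exact_mod_cast this
    calc ‖x‖ ^ (n + 2) / ((n + 2)! : ℝ) ≤ ‖x‖ ^ (n + 2) / (2 * n ! : ℝ) := by gcongr
      _ = _ := by rw [pow_add]; field_simp
  simpa [Finset.sum_range_succ] using h3

end Exponential

/-! ### Distance from the mean product to the exponential -/

section Bias

variable {𝕜 ι : Type*} [RCLike 𝕜] [Fintype ι] [DecidableEq ι]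

theorem norm_one_add_smul_le [Nonempty ι] {A : Matrix ι ι 𝕜} {L : ℝ} (hA : ‖A‖ ≤ L) (n : ℕ) :
    ‖1 + (n : 𝕜)⁻¹ • A‖ ≤ 1 + L / n := by
  refine (norm_add_le _ _).trans ?_
  rw [norm_one, norm_smul, norm_inv, RCLike.norm_natCast, div_eq_inv_mul]
  gcongr

theorem one_add_div_pow_le_exp {L : ℝ} (hL : 0 ≤ L) {m n : ℕ} (hmn : m ≤ n) :
    (1 + L / n) ^ m ≤ Real.exp L := by
  rcases Nat.eq_zero_or_pos n with rfl | hn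
  · obtain rfl : m = 0 := by omega
    simpa using hL
  have hn' : (0 : ℝ) < n := by exact_mod_cast hn
  have hbase : 1 ≤ 1 + L / (n : ℝ) := by
    have : 0 ≤ L / (n : ℝ) := by positivity
    linarith
  calc (1 + L / n) ^ m ≤ (1 + L / n) ^ n := pow_le_pow_right₀ hbase hmn
    _ ≤ Real.exp (L / n) ^ n := by
        gcongr
        rw [add_comm]
        exact Real.add_one_le_exp _
    _ = Real.exp L := by
        rw [← Real.exp_nat_mul]
        congr 1
        field_simp

/-- With x = M/n, both 1 + x and e^x have norm at most e^{L/n} and differ by at most (L/n)²/2 ·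
e^{L/n}. Telescoping the nth powers collects exactly n factors e^{L/n}, that is e^L. -/
theorem norm_one_add_smul_pow_sub_exp_le [Nonempty ι] {M : Matrix ι ι 𝕜} {L : ℝ} (hM : ‖M‖ ≤ L)
    {n : ℕ} (hn : 0 < n) :
    ‖(1 + (n : 𝕜)⁻¹ • M) ^ n - NormedSpace.exp M‖ ≤ L ^ 2 * Real.exp L / (2 * n) := by
  have : CompleteSpace (Matrix ι ι 𝕜) := FiniteDimensional.complete 𝕜 _
  have hn' : (0 : ℝ) < n := by exact_mod_cast hn
  have hn𝕜 : (n : 𝕜) ≠ 0 := by exact_mod_cast hn.ne'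
  have hL : 0 ≤ L := (norm_nonneg M).trans hM
  set x : Matrix ι ι 𝕜 := (n : 𝕜)⁻¹ • M with hx
  have hxn : ‖x‖ ≤ L / n := by
    rw [hx, norm_smul, norm_inv, RCLike.norm_natCast, div_eq_inv_mul]
    gcongr
  have hexp : NormedSpace.exp M = NormedSpace.exp x ^ n := by
    rw [← Matrix.exp_nsmul, hx, ← Nat.cast_smul_eq_nsmul 𝕜, smul_smul, mul_inv_cancel₀ hn𝕜,
      one_smul]
  have ha : ‖1 + x‖ ≤ Real.exp (L / n) := (norm_one_add_smul_le hM n).trans (by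
    rw [add_comm]
    exact Real.add_one_le_exp _)
  have hb : ‖NormedSpace.exp x‖ ≤ Real.exp (L / n) :=
    (NormedSpace.norm_exp_le_exp_norm 𝕜 x).trans (Real.exp_le_exp.2 hxn)
  have hd : ‖1 + x - NormedSpace.exp x‖ ≤ (L / n) ^ 2 / 2 * Real.exp (L / n) := by
    rw [norm_sub_rev]
    refine (NormedSpace.norm_exp_sub_one_sub_self_le 𝕜 x).trans ?_
    gcongr
  obtain ⟨k, rfl⟩ : ∃ k, n = k + 1 := ⟨n - 1, by omega⟩
  rw [hexp]
  refine (norm_pow_succ_sub_pow_succ_le ha hb k).trans ?_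
  calc ((k : ℝ) + 1) * Real.exp (L / (k + 1 : ℕ)) ^ k * ‖1 + x - NormedSpace.exp x‖
      ≤ ((k : ℝ) + 1) * Real.exp (L / (k + 1 : ℕ)) ^ k *
        ((L / (k + 1 : ℕ)) ^ 2 / 2 * Real.exp (L / (k + 1 : ℕ))) := by gcongr
    _ = ((k : ℝ) + 1) * ((L / (k + 1 : ℕ)) ^ 2 / 2) * Real.exp (L / (k + 1 : ℕ)) ^ (k + 1) := by
        rw [pow_succ]
        ring
    _ = L ^ 2 * Real.exp L / (2 * (k + 1 : ℕ)) := by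
        rw [← Real.exp_nat_mul]
        have e : ((k + 1 : ℕ) : ℝ) * (L / (k + 1 : ℕ)) = L := by field_simp
        rw [e]
        push_cast
        field_simp

end Bias

/-! ### Measurability, independence and orthogonality -/

section Independence

open scoped Matrix

variable {𝕜 : Type*} [RCLike 𝕜] {d : ℕ}

instance matrixBorelSpace : BorelSpace (Matrix (Fin d) (Fin d) 𝕜) :=
  inferInstanceAs (BorelSpace (Fin d → Fin d → 𝕜))

instance matrixSecondCountableTopology : SecondCountableTopology (Matrix (Fin d) (Fin d) 𝕜) :=
  inferInstanceAs (SecondCountableTopology (Fin d → Fin d → 𝕜))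

variable {Ω : Type*} [MeasurableSpace Ω] {P : Measure Ω}

/-- The mean is only entrywise, so the bound is obtained by duality: for w = Mv, ‖w‖² = E⟨w, Xv⟩ ≤
‖w‖ L ‖v‖. -/
theorem norm_le_of_forall_integral_eq [IsProbabilityMeasure P] {L : ℝ} {M : Matrix (Fin d) (Fin d) 𝕜}
    {X : Ω → Matrix (Fin d) (Fin d) 𝕜} (hX : Measurable X)
    (hM : ∀ i j, ∫ ω, X ω i j ∂P = M i j) (hb : ∀ᵐ ω ∂P, ‖X ω‖ ≤ L) : ‖M‖ ≤ L := by
  have : ProperSpace (Matrix (Fin d) (Fin d) 𝕜) := FiniteDimensional.proper 𝕜 _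
  have hL : 0 ≤ L := by
    obtain ⟨ω, hω⟩ := hb.exists
    exact (norm_nonneg _).trans hω
  have hint : ∀ i j, Integrable (fun ω => X ω i j) P := fun i j =>
    integrable_comp_of_bounded (f := fun A : Matrix (Fin d) (Fin d) 𝕜 => A i j)
      (continuous_id.matrix_elem i j) hX.aestronglyMeasurable hb
  refine Matrix.l2_opNorm_le_of_forall hL fun v => ?_
  set w := M *ᵥ v with hw
  have hφ : ∀ A : Matrix (Fin d) (Fin d) 𝕜, inner 𝕜 (WithLp.toLp 2 w) (WithLp.toLp 2 (A *ᵥ v))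
      = ∑ i, ∑ j, A i j * (v j * star (w i)) := by
    intro A
    rw [PiLp.inner_apply]
    refine Finset.sum_congr rfl fun i _ => ?_
    simp only [RCLike.inner_apply, Matrix.mulVec, dotProduct, Finset.sum_mul, RCLike.star_def,
      mul_assoc]
  have hE : ∫ ω, inner 𝕜 (WithLp.toLp 2 w) (WithLp.toLp 2 (X ω *ᵥ v)) ∂P
      = inner 𝕜 (WithLp.toLp 2 w) (WithLp.toLp 2 w) := by
    conv_rhs => rw [hw]
    rw [← hw, hφ M]
    simp only [hφ]
    rw [integral_finsetSum _ fun i _ => integrable_finsetSum _ fun j _ =>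
      (hint i j).mul_const _]
    refine Finset.sum_congr rfl fun i _ => ?_
    rw [integral_finsetSum _ fun j _ => (hint i j).mul_const _]
    refine Finset.sum_congr rfl fun j _ => ?_
    rw [integral_mul_const, hM]
  have hle : ‖WithLp.toLp 2 w‖ * ‖WithLp.toLp 2 w‖
      ≤ ‖WithLp.toLp 2 w‖ * (L * ‖WithLp.toLp 2 v‖) := by
    rw [← inner_self_eq_norm_mul_norm (𝕜 := 𝕜), ← hE]
    refine (RCLike.re_le_norm _).trans ?_
    refine (norm_integral_le_of_norm_le_const
      (C := ‖WithLp.toLp 2 w‖ * (L * ‖WithLp.toLp 2 v‖)) ?_).trans_eq (by simp)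
    filter_upwards [hb] with ω hω
    refine (norm_inner_le_norm _ _).trans ?_
    gcongr
    exact ((X ω).l2_opNorm_mulVec (WithLp.toLp 2 v)).trans (by gcongr)
  have hle2 : ‖WithLp.toLp 2 w‖ ≤ L * ‖WithLp.toLp 2 v‖ := by
    rcases (norm_nonneg (WithLp.toLp 2 w)).eq_or_lt with h | h
    · rw [← h]
      positivity
    · exact le_of_mul_le_mul_left hle h
  have := pow_le_pow_left₀ (norm_nonneg _) hle2 2
  rwa [mul_pow, EuclideanSpace.norm_sq_eq, EuclideanSpace.norm_sq_eq] at this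

theorem integral_re_trace_sub_mul_eq_zero [IsProbabilityMeasure P] {R : ℝ} {M : Matrix (Fin d) (Fin d) 𝕜}
    {X Z : Ω → Matrix (Fin d) (Fin d) 𝕜} (hX : Measurable X) (hZ : Measurable Z)
    (hind : IndepFun X Z P) (hM : ∀ i j, ∫ ω, X ω i j ∂P = M i j)
    (hXb : ∀ᵐ ω ∂P, ‖X ω‖ ≤ R) (hZb : ∀ᵐ ω ∂P, ‖Z ω‖ ≤ R)
    {g : Matrix (Fin d) (Fin d) 𝕜 → Matrix (Fin d) (Fin d) 𝕜} (hg : Continuous g) :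
    ∫ ω, RCLike.re ((X ω - M) * g (Z ω)).trace ∂P = 0 := by
  have : ProperSpace (Matrix (Fin d) (Fin d) 𝕜) := FiniteDimensional.proper 𝕜 _
  have hXi : ∀ a b, Integrable (fun ω => X ω a b) P := fun i j =>
    integrable_comp_of_bounded (f := fun A : Matrix (Fin d) (Fin d) 𝕜 => A i j)
      (continuous_id.matrix_elem i j) hX.aestronglyMeasurable hXb
  have hi : ∀ a b, Integrable (fun ω => (X ω a b - M a b) * g (Z ω) b a) P := fun a b => by
    refine integrable_comp_of_bounded (Z := fun ω => (X ω, Z ω)) (R := R)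
      (f := fun z : Matrix (Fin d) (Fin d) 𝕜 × Matrix (Fin d) (Fin d) 𝕜 =>
        (z.1 a b - M a b) * g z.2 b a) ?_
      (hX.aestronglyMeasurable.prodMk hZ.aestronglyMeasurable) ?_
    · exact ((continuous_fst.matrix_elem a b).sub continuous_const).mul
        ((hg.comp continuous_snd).matrix_elem b a)
    · filter_upwards [hXb, hZb] with ω h1 h2
      exact max_le h1 h2
  have hz : ∀ a b, ∫ ω, (X ω a b - M a b) * g (Z ω) b a ∂P = 0 := fun a b => by
    have h := hind.integral_fun_comp_mul_comp (f := fun A => A a b - M a b)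
      (g := fun A => g A b a) hX.aemeasurable hZ.aemeasurable
      ((continuous_id.matrix_elem a b).sub continuous_const).aestronglyMeasurable
      (hg.matrix_elem b a).aestronglyMeasurable
    rw [h, integral_sub (hXi a b) (integrable_const _), hM]
    simp
  have hs : ∀ ω, ((X ω - M) * g (Z ω)).trace = ∑ a, ∑ b, (X ω a b - M a b) * g (Z ω) b a :=
    fun ω => by
      rw [Matrix.trace_mul_eq_sum]
      rfl
  simp only [hs]
  rw [integral_re (integrable_finsetSum _ fun a _ => integrable_finsetSum _ fun b _ => hi a b),
    integral_finsetSum _ fun a _ => integrable_finsetSum _ fun b _ => hi a b]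
  have hz2 : ∀ a, ∫ ω, ∑ b, (X ω a b - M a b) * g (Z ω) b a ∂P = 0 := fun a => by
    rw [integral_finsetSum _ fun b _ => hi a b]
    exact Finset.sum_eq_zero fun b _ => hz a b
  simp [hz2]

theorem measurable_one_add_smul_mul {α : Type*} {mα : MeasurableSpace α}
    {A B : α → Matrix (Fin d) (Fin d) 𝕜} (c : 𝕜) (hA : Measurable A) (hB : Measurable B) :
    Measurable (fun a => (1 + c • A a) * B a) := by
  have hA' : ∀ i j, Measurable fun a => A a i j := fun i j =>
    (continuous_id.matrix_elem i j).measurable.comp hA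
  have hB' : ∀ i j, Measurable fun a => B a i j := fun i j =>
    (continuous_id.matrix_elem i j).measurable.comp hB
  refine measurable_pi_iff.2 fun i => measurable_pi_iff.2 fun j => ?_
  have e : (fun a => ((1 + c • A a) * B a) i j)
      = fun a => ∑ k, ((1 : Matrix (Fin d) (Fin d) 𝕜) i k + c * A a i k) * B a k j := by
    funext a
    simp only [Matrix.mul_apply, Matrix.add_apply, Matrix.smul_apply, smul_eq_mul]
  change Measurable (fun a => ((1 + c • A a) * B a) i j)
  rw [e]
  exact Finset.measurable_fun_sum _ fun k _ =>
    (measurable_const.add ((hA' i k).const_mul c)).mul (hB' k j)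

/-- Adaptedness to the σ-algebra of the first m factors, which is independent of the next one. -/
theorem measurable_partialProd {Ω : Type*} (X : ℤ → Ω → Matrix (Fin d) (Fin d) 𝕜) (n m : ℕ) :
    Measurable[⨆ k ∈ Set.Icc (1 : ℤ) m, MeasurableSpace.comap (X k) inferInstance]
      (fun ω => partialProd (fun k => X k ω) n m) := by
  induction m with
  | zero => exact measurable_const
  | succ m ih =>
    have h1 : Measurable[⨆ k ∈ Set.Icc (1 : ℤ) ((m + 1 : ℕ) : ℤ),
        MeasurableSpace.comap (X k) inferInstance] (X ((m : ℤ) + 1)) := by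
      refine Measurable.mono (comap_measurable (X ((m : ℤ) + 1))) ?_ le_rfl
      exact le_biSup (fun k => MeasurableSpace.comap (X k) inferInstance)
        (show (m : ℤ) + 1 ∈ Set.Icc (1 : ℤ) ((m + 1 : ℕ) : ℤ) from
          ⟨by omega, by push_cast; rfl⟩)
    have h2 : Measurable[⨆ k ∈ Set.Icc (1 : ℤ) ((m + 1 : ℕ) : ℤ),
        MeasurableSpace.comap (X k) inferInstance]
        (fun ω => partialProd (fun k => X k ω) n m) := by
      refine ih.mono ?_ le_rfl
      refine biSup_mono fun k hk => ⟨hk.1, hk.2.trans ?_⟩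
      push_cast
      omega
    exact measurable_one_add_smul_mul _ h1 h2

theorem indepFun_partialProd {X : ℤ → Ω → Matrix (Fin d) (Fin d) 𝕜}
    (hX : ∀ k, Measurable (X k))
    (hind : iIndepFun X P) (n m : ℕ) :
    IndepFun (X ((m : ℤ) + 1)) (fun ω => partialProd (fun k => X k ω) n m) P := by
  rw [IndepFun_iff_Indep]
  have hdisj : Disjoint ({(m : ℤ) + 1} : Set ℤ) (Set.Icc (1 : ℤ) m) := by
    rw [Set.disjoint_singleton_left, Set.mem_Icc]
    omega
  have h := indep_iSup_of_disjoint (fun k => (hX k).comap_le) hind.iIndep hdisj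
  refine indep_of_indep_of_le_right (indep_of_indep_of_le_left h ?_)
    (measurable_partialProd X n m).comap_le
  exact le_biSup (fun k => MeasurableSpace.comap (X k) inferInstance) (Set.mem_singleton _)

theorem norm_partialProd_le (hd : 0 < d) {L : ℝ} {A : ℤ → Matrix (Fin d) (Fin d) 𝕜}
    (hA : ∀ k, ‖A k‖ ≤ L) (n m : ℕ) : ‖partialProd A n m‖ ≤ (1 + L / n) ^ m := by
  have : Nonempty (Fin d) := ⟨⟨0, hd⟩⟩
  have hL : 0 ≤ L := (norm_nonneg _).trans (hA 0)
  induction m with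
  | zero => simp [partialProd]
  | succ m ih =>
    rw [partialProd, pow_succ']
    refine (norm_mul_le _ _).trans ?_
    gcongr
    exact norm_one_add_smul_le (hA _) n

end Independence

/-! ### Concentration, choice of the threshold, and the rate -/

section Main

open scoped Matrix

variable {𝕜 : Type*} [RCLike 𝕜] {d : ℕ}

theorem partialProd_increment (M : Matrix (Fin d) (Fin d) 𝕜) (A : ℤ → Matrix (Fin d) (Fin d) 𝕜)
    {n m : ℕ} (hm : m < n) :
    (1 + (n : 𝕜)⁻¹ • M) ^ (n - (m + 1)) * partialProd A n (m + 1)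
        - (1 + (n : 𝕜)⁻¹ • M) ^ (n - m) * partialProd A n m
      = (1 + (n : 𝕜)⁻¹ • M) ^ (n - (m + 1)) *
          ((n : 𝕜)⁻¹ • (A ((m : ℤ) + 1) - M) * partialProd A n m) := by
  have e : n - m = n - (m + 1) + 1 := by omega
  rw [e, pow_succ, partialProd, mul_assoc, ← mul_sub, ← sub_mul, smul_sub]
  congr 2
  abel

variable {Ω : Type*} [MeasurableSpace Ω] {P : Measure Ω} [IsProbabilityMeasure P]

theorem IsBoundedIndepSeq.measureReal_le_norm_sub_le {L : ℝ} (hL : 0 < L) {n : ℕ} (hd : 0 < d)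
    (hn : 0 < n) {M : Matrix (Fin d) (Fin d) 𝕜} {X : ℤ → Ω → Matrix (Fin d) (Fin d) 𝕜}
    (hX : IsBoundedIndepSeq P L M X) {t : ℝ} (ht : 0 < t) :
    P.real {ω | t ≤ ‖normalizedProd (fun k => X k ω) n - (1 + (n : 𝕜)⁻¹ • M) ^ n‖}
      ≤ 4 * d * Real.exp (-(t ^ 2 / (4 * n * (2 * L * Real.exp L / n) ^ 2))) := by
  have : Nonempty (Fin d) := ⟨⟨0, hd⟩⟩
  have hn' : (0 : ℝ) < n := by exact_mod_cast hn
  have hM : ‖M‖ ≤ L := norm_le_of_forall_integral_eq (hX.measurable 0) (hX.mean 0) (hX.bound 0)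
  have hb : ∀ᵐ ω ∂P, ∀ k, ‖X k ω‖ ≤ L := ae_all_iff.2 hX.bound
  set B : Matrix (Fin d) (Fin d) 𝕜 := 1 + (n : 𝕜)⁻¹ • M with hB
  have hBn : ‖B‖ ≤ 1 + L / n := norm_one_add_smul_le hM n
  have hmeas : ∀ m, Measurable (fun ω => partialProd (fun k => X k ω) n m) := fun m =>
    (measurable_partialProd X n m).mono (iSup₂_le fun k _ => (hX.measurable k).comap_le) le_rfl
  -- Y vanishes at m = 0 and is the whole fluctuation at m = n. An increment contains one centred
  -- factor, of norm at most 2L/n, and n - 1 factors of norm at most 1 + L/n.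
  set Y : ℕ → Ω → Matrix (Fin d) (Fin d) 𝕜 := fun m ω =>
    B ^ (n - m) * partialProd (fun k => X k ω) n m - B ^ n with hY
  have hdiff : ∀ m < n, ∀ ω, Y (m + 1) ω - Y m ω
      = B ^ (n - (m + 1)) * ((n : 𝕜)⁻¹ • (X ((m : ℤ) + 1) ω - M) *
        partialProd (fun k => X k ω) n m) := fun m hm ω => by
    simp only [hY, sub_sub_sub_cancel_right]
    exact partialProd_increment M (fun k => X k ω) hm
  have key := measureReal_le_norm_le_exp_sq (P := P) (Y := Y) hn
    (c := 2 * L * Real.exp L / n) (by positivity)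
    (fun m => (((continuous_const.mul continuous_id).sub continuous_const).measurable.comp
      (hmeas m)).aestronglyMeasurable)
    (fun ω => by simp [hY, partialProd])
    (fun m hm => by
      filter_upwards [hb] with ω hω
      rw [hdiff m hm]
      have h1 : ‖B ^ (n - (m + 1))‖ ≤ (1 + L / n) ^ (n - (m + 1)) :=
        (norm_pow_le _ _).trans (pow_le_pow_left₀ (norm_nonneg _) hBn _)
      have h2 : ‖(n : 𝕜)⁻¹ • (X ((m : ℤ) + 1) ω - M)‖ ≤ 2 * L / n := by
        rw [norm_smul, norm_inv, RCLike.norm_natCast, div_eq_inv_mul]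
        gcongr
        have := norm_sub_le (X ((m : ℤ) + 1) ω) M
        have := hω ((m : ℤ) + 1)
        linarith
      have h3 := norm_partialProd_le hd hω n m
      have hpos : 0 ≤ 1 + L / (n : ℝ) := by positivity
      calc _ ≤ (1 + L / n) ^ (n - (m + 1)) * (2 * L / n * (1 + L / n) ^ m) := by
            refine (norm_mul_le _ _).trans ?_
            gcongr
            refine (norm_mul_le _ _).trans ?_
            gcongr
        _ = 2 * L / n * (1 + L / n) ^ (n - (m + 1) + m) := by rw [pow_add]; ring
        _ ≤ 2 * L / n * Real.exp L := by
            gcongr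
            exact one_add_div_pow_le_exp hL.le (by omega)
        _ = 2 * L * Real.exp L / n := by ring)
    (fun m hm W hW => by
      set R := max L ((1 + L / n) ^ m)
      have h := integral_re_trace_sub_mul_eq_zero (P := P) (R := R) (hX.measurable ((m : ℤ) + 1))
        (hmeas m) (indepFun_partialProd hX.measurable hX.indep n m) (hX.mean _)
        (by filter_upwards [hb] with ω hω using (hω _).trans (le_max_left _ _))
        (by
          filter_upwards [hb] with ω hω
          exact (norm_partialProd_le hd hω n m).trans (le_max_right _ _))
        -- Cyclicity moves the left power of B to the end, so that everything beside the centred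
        -- factor is a continuous function of the past product z.
        (g := fun z => (n : 𝕜)⁻¹ • (z * W (B ^ (n - m) * z - B ^ n) * B ^ (n - (m + 1))))
        (((continuous_id.mul (hW.comp ((continuous_const.mul continuous_id).sub
          continuous_const))).mul continuous_const).fun_const_smul _)
      rw [← h]
      refine integral_congr_ae (Filter.Eventually.of_forall fun ω => ?_)
      simp only [hdiff m hm]
      rw [mul_assoc (B ^ (n - (m + 1))), Matrix.trace_mul_comm, smul_mul_assoc, smul_mul_assoc,
        smul_mul_assoc, mul_smul_comm]
      simp only [mul_assoc, hY])
    ht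
  simpa [hY, normalizedProd] using key

theorem two_le_log_of_admissible {L δ : ℝ} {n : ℕ} (h : Admissible L n d δ) :
    2 ≤ Real.log n := by
  have h1 := h.1
  have : ((3 : ℤ) : ℝ) ≤ ((max 3 ⌈L * Real.exp 1 ^ 2⌉ : ℤ) : ℝ) := by
    exact_mod_cast le_max_left _ _
  push_cast at this h1
  linarith

/-- At the threshold t the Azuma exponent is l²(q + l²), where l = log n and q = log(2d/δ). As l ≥ 2
this is at least q + 1, so the tail is at most 2δ/e < δ. The resulting probability 1 - δ serves both
conclusions, without rescaling δ. -/
theorem IsBoundedIndepSeq.lt_measureReal_norm_sub_exp_le {L : ℝ} (hL : 0 < L) {n : ℕ} {δ : ℝ}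
    (hd : 0 < d) (hδ : 0 < δ) (hδ2 : δ ≤ 1 / 2) (hn : 2 ≤ Real.log n)
    {M : Matrix (Fin d) (Fin d) 𝕜} {X : ℤ → Ω → Matrix (Fin d) (Fin d) 𝕜}
    (hX : IsBoundedIndepSeq P L M X) :
    1 - δ < P.real {ω | ‖normalizedProd (fun k => X k ω) n - NormedSpace.exp M‖ ≤
          2 * L * Real.exp L * Real.log n / √(n : ℝ) *
              (2 * √(Real.log (2 * d / δ) + Real.log n ^ 2) + Real.log n / √(n : ℝ))
            + L ^ 2 * Real.exp L / (2 * n)} := by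
  have : Nonempty (Fin d) := ⟨⟨0, hd⟩⟩
  have hn0 : 0 < n := by
    rcases Nat.eq_zero_or_pos n with rfl | h
    · norm_num at hn
    · exact h
  have hn' : (0 : ℝ) < n := by exact_mod_cast hn0
  have hd' : (1 : ℝ) ≤ d := by exact_mod_cast hd
  have hM : ‖M‖ ≤ L := norm_le_of_forall_integral_eq (hX.measurable 0) (hX.mean 0) (hX.bound 0)
  set l := Real.log n with hl
  have hq : 0 < Real.log (2 * d / δ) := by
    refine Real.log_pos ?_
    rw [lt_div_iff₀ hδ]
    linarith
  set q := Real.log (2 * d / δ) with hqdef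
  set t := 2 * L * Real.exp L * l / √(n : ℝ) * (2 * √(q + l ^ 2)) with ht
  have hV : 0 < √(q + l ^ 2) := Real.sqrt_pos.2 (by positivity)
  have ht0 : 0 < t := by positivity
  have htail := hX.measureReal_le_norm_sub_le hL hd hn0 ht0
  have hexp : t ^ 2 / (4 * n * (2 * L * Real.exp L / n) ^ 2) = l ^ 2 * (q + l ^ 2) := by
    rw [ht, mul_pow, mul_pow 2, Real.sq_sqrt (by positivity), div_pow, Real.sq_sqrt hn'.le]
    field_simp
    ring
  have hsmall : 4 * d * Real.exp (-(t ^ 2 / (4 * n * (2 * L * Real.exp L / n) ^ 2))) < δ := by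
    rw [hexp]
    have h1 : q + 1 ≤ l ^ 2 * (q + l ^ 2) := by
      have h4 : 4 ≤ l ^ 2 := by nlinarith
      nlinarith
    have h2 : Real.exp (-(l ^ 2 * (q + l ^ 2))) ≤ Real.exp (-(q + 1)) :=
      Real.exp_le_exp.2 (by linarith)
    have h3 : Real.exp (-(q + 1)) = δ / (2 * d) * Real.exp (-1) := by
      rw [neg_add, Real.exp_add, Real.exp_neg q, hqdef, Real.exp_log (by positivity), inv_div]
    have h4 : Real.exp (-1) < 1 / 2 := by
      rw [Real.exp_neg, inv_lt_comm₀ (Real.exp_pos 1) (by norm_num)]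
      have := Real.exp_one_gt_d9
      norm_num
      linarith
    calc 4 * d * Real.exp (-(l ^ 2 * (q + l ^ 2))) ≤ 4 * d * (δ / (2 * d) * Real.exp (-1)) := by
          rw [← h3]
          gcongr
      _ = 2 * δ * Real.exp (-1) := by field_simp; norm_num
      _ < 2 * δ * (1 / 2) := by gcongr
      _ = δ := by ring
  set S := {ω | ‖normalizedProd (fun k => X k ω) n - NormedSpace.exp M‖ ≤
          2 * L * Real.exp L * l / √(n : ℝ) * (2 * √(q + l ^ 2) + l / √(n : ℝ))
            + L ^ 2 * Real.exp L / (2 * n)} with hS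
  have hcover : Set.univ ⊆ S ∪
      {ω | t ≤ ‖normalizedProd (fun k => X k ω) n - (1 + (n : 𝕜)⁻¹ • M) ^ n‖} := by
    intro ω _
    by_contra hcon
    rw [Set.mem_union, not_or, hS, Set.mem_ofPred_eq, Set.mem_ofPred_eq, not_le, not_le] at hcon
    have hbias := norm_one_add_smul_pow_sub_exp_le hM hn0
    have htri := norm_sub_le_norm_sub_add_norm_sub (normalizedProd (fun k => X k ω) n)
      ((1 + (n : 𝕜)⁻¹ • M) ^ n) (NormedSpace.exp M)
    -- The second summand of the stated bound is pure slack beyond t and the bias.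
    have hextra : 0 ≤ 2 * L * Real.exp L * l / √(n : ℝ) * (l / √(n : ℝ)) := by positivity
    have h1 := hcon.1
    have h2 := hcon.2
    rw [mul_add] at h1
    linarith
  have h1 : (1 : ℝ) ≤ P.real S + _ :=
    calc (1 : ℝ) = P.real Set.univ := by simp
      _ ≤ _ := measureReal_mono hcover
      _ ≤ _ := measureReal_union_le _ _
  linarith

/-- Since log(d/δ) ≥ log 2 > 1/2 and log n ≥ 2, sums of these quantities are absorbed into products.
The constant is 16 = 2(2·3 + 2), from the bounds 3lq on the square root and 2lq on l/√n, where now q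
= log(d/δ). -/
theorem explicit_bound_le_rate {L δ : ℝ} (hL : 0 < L) {n d : ℕ} (hd : 0 < d) (hδ : 0 < δ)
    (hδ2 : δ ≤ 1 / 2) (hn : 2 ≤ Real.log n) :
    2 * L * Real.exp L * Real.log n / √(n : ℝ) *
        (2 * √(Real.log (2 * d / δ) + Real.log n ^ 2) + Real.log n / √(n : ℝ))
      + L ^ 2 * Real.exp L / (2 * n)
    ≤ (16 * L * Real.exp L + L ^ 2 * Real.exp L) *
        (Real.log n ^ 2 * Real.log (d / δ) / √(n : ℝ)) := by
  have hn0 : 0 < n := by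
    rcases Nat.eq_zero_or_pos n with rfl | h
    · norm_num at hn
    · exact h
  have hn1 : (1 : ℝ) ≤ n := by exact_mod_cast hn0
  have hd' : (1 : ℝ) ≤ d := by exact_mod_cast hd
  have hlog2 := Real.log_two_gt_d9
  have hq2 : Real.log 2 ≤ Real.log (d / δ) := by
    refine Real.log_le_log (by norm_num) ?_
    rw [le_div_iff₀ hδ]
    linarith
  have hsplit : Real.log (2 * d / δ) = Real.log 2 + Real.log (d / δ) := by
    rw [mul_div_assoc, Real.log_mul (by norm_num) (by positivity)]
  rw [hsplit]
  set l := Real.log n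
  set q := Real.log (d / δ)
  have hq : 1 / 2 ≤ q := by linarith
  have hlq : 1 ≤ l * q := by nlinarith
  have hs1 : 1 ≤ √(n : ℝ) := Real.one_le_sqrt.2 hn1
  have hss : √(n : ℝ) * √(n : ℝ) = n := Real.mul_self_sqrt (by positivity)
  set s := √(n : ℝ)
  have hV : √(Real.log 2 + q + l ^ 2) ≤ 3 * (l * q) := by
    rw [Real.sqrt_le_left (by positivity)]
    have h1 : l ^ 2 * 1 ≤ l ^ 2 * (4 * q ^ 2) := by
      gcongr
      nlinarith
    have h2 : 2 * q ≤ 4 * q ^ 2 := by nlinarith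
    have h3 : 1 * (4 * q ^ 2) ≤ l ^ 2 * (4 * q ^ 2) := by
      gcongr
      nlinarith
    nlinarith
  have hls : l / s ≤ 2 * (l * q) := by
    rw [div_le_iff₀ (by positivity)]
    have : l ≤ 2 * (l * q) := by nlinarith
    have h0 : 0 ≤ 2 * (l * q) := by positivity
    nlinarith
  have hpre : 0 ≤ 2 * L * Real.exp L * l / s := by positivity
  have hA : 2 * L * Real.exp L * l / s * (2 * √(Real.log 2 + q + l ^ 2) + l / s)
      ≤ 16 * L * Real.exp L * (l ^ 2 * q / s) := by
    calc _ ≤ 2 * L * Real.exp L * l / s * (8 * (l * q)) := by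
          gcongr
          linarith
      _ = _ := by ring
  have hB : L ^ 2 * Real.exp L / (2 * n) ≤ L ^ 2 * Real.exp L * (l ^ 2 * q / s) := by
    rw [div_eq_mul_inv]
    gcongr
    rw [← one_div, div_le_div_iff₀ (by positivity) (by positivity)]
    have h1 : 1 ≤ l ^ 2 * q := by nlinarith
    have h2 : s ≤ 2 * n := by nlinarith
    nlinarith
  rw [add_mul]
  exact add_le_add hA hB

end Main

theorem theorem1 {𝕜 : Type*} [RCLike 𝕜] (L : ℝ) (hL : 0 < L) :
    -- the explicit bound
    (∀ (n d : ℕ) (δ : ℝ), 0 < d → 0 < δ → δ ≤ 1 / 2 → Admissible L n d δ →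
      ∀ (Ω : Type*) [MeasurableSpace Ω] (P : Measure Ω) [IsProbabilityMeasure P]
        (M : Matrix (Fin d) (Fin d) 𝕜) (X : ℤ → Ω → Matrix (Fin d) (Fin d) 𝕜),
        IsBoundedIndepSeq P L M X →
        1 - 2 * δ < P.real {ω | ‖normalizedProd (fun k => X k ω) n - NormedSpace.exp M‖ ≤
          2 * L * Real.exp L * Real.log n / √(n : ℝ) *
              (2 * √(Real.log (2 * d / δ) + Real.log n ^ 2) + Real.log n / √(n : ℝ))
            + L ^ 2 * Real.exp L / (2 * n)}) ∧
    -- the rate, with a constant that depends only on `L`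
    (∃ C : ℝ, ∀ (n d : ℕ) (δ : ℝ), 0 < d → 0 < δ → δ ≤ 1 / 2 → Admissible L n d δ →
      ∀ (Ω : Type*) [MeasurableSpace Ω] (P : Measure Ω) [IsProbabilityMeasure P]
        (M : Matrix (Fin d) (Fin d) 𝕜) (X : ℤ → Ω → Matrix (Fin d) (Fin d) 𝕜),
        IsBoundedIndepSeq P L M X →
        1 - δ < P.real {ω | ‖normalizedProd (fun k => X k ω) n - NormedSpace.exp M‖ ≤
          C * (Real.log n ^ 2 * Real.log (d / δ) / √(n : ℝ))}) := by
  refine ⟨?_, 16 * L * Real.exp L + L ^ 2 * Real.exp L, ?_⟩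
  · intro n d δ hd hδ hδ2 hadm Ω _ P _ M X hX
    have := hX.lt_measureReal_norm_sub_exp_le hL hd hδ hδ2 (two_le_log_of_admissible hadm)
    linarith
  · intro n d δ hd hδ hδ2 hadm Ω _ P _ M X hX
    have hn := two_le_log_of_admissible hadm
    refine (hX.lt_measureReal_norm_sub_exp_le hL hd hδ hδ2 hn).trans_le ?_
    exact measureReal_mono fun ω hω => le_trans hω (explicit_bound_le_rate hL hd hδ hδ2 hn)
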